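/- Let $N\in\{2,3\}$, let $\Omega\subset\mathbb R^N$ be a convex polygonal ($N=2$) or polyhedral ($N=3$) bounded domain, and let $N/2<p\le\infty$. Let $\{\mathcal T_h\}$ be a shape-regular, quasi-uniform family of conforming simplicial meshes of $\Omega$ ($h$ denotes the largest diameter of a cell), and let $V_h\subset H^1_0(\Omega)\cap C(\bar\Omega)$ be the space of continuous functions on $\bar\Omega$ which vanish on $\partial\Omega$ and are affine on each cell of $\mathcal T_h$. Then there is a constant $c\ge 0$ such that the following holds for every mesh $\mathcal T_h$ of the family, every $f\in L^p(\Omega)$ and every $d\colon\Omega\times\mathbb R\to\mathbb R$ satisfying: (i) $d(\cdot,u_0)\in L^\infty(\Omega)$ for every $u_0\in\mathbb R$; (ii) $d(x,\cdot)$ is monotonically non-decreasing for almost all $x\in\Omega$; (iii) for every $u_0\in\mathbb R$ and every $\varepsilon>0$ there is $\delta>0$ such that $|d(x,u)-d(x,u_0)|<\varepsilon$ for all $u\in\mathbb R$ with $|u-u_0|<\delta$ and for almost all $x\in\Omega$. The discrete problem: find $u_h\in V_h$ such that $$\int_\Omega\nabla u_h\cdot\nabla\varphi_h\,dx+\int_\Omega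 d(x,u_h(x))\,\varphi_h(x)\,dx=\int_\Omega f\,\varphi_h\,dx\qquad\text{for all }\varphi_h\in V_h$$ is well defined (for all $u_h,\varphi_h\in V_h$ the three integrals exist) and has exactly one solution $u_h$, and $$\|\nabla u_h\|_{L^2(\Omega)}\le c\left(\|f\|_{L^p(\Omega)}+\|d(\cdot,0)\|_{L^\infty(\Omega)}\right).$$ In particular, $c$ is independent of $f$, $d$ and $h$. -/

import Mathlib

open MeasureTheory
open scoped ENNReal NNReal Gradient

noncomputable section

namespace SemilinearFEM

/-- Euclidean space `ℝ^N`. -/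
abbrev Space (N : ℕ) : Type := EuclideanSpace ℝ (Fin N)

/-- `Ω` is a convex polygonal (`N = 2`) or polyhedral (`N = 3`) domain: nonempty, open, convex,
and its closure is the convex hull of finitely many points (so `Ω` is bounded). -/
structure IsConvexPolyhedralDomain {N : ℕ} (Ω : Set (Space N)) : Prop where
  isOpen : IsOpen Ω
  nonempty : Ω.Nonempty
  convex : Convex ℝ Ω
  polytope : ∃ S : Finset (Space N), closure Ω = convexHull ℝ (S : Set (Space N))

/-- The assumption on the nonlinearity `d : Ω × ℝ → ℝ`; only the values of `d` at points of `Ω`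
are used. -/
structure NonlinearityAssumption {N : ℕ} (Ω : Set (Space N)) (d : Space N → ℝ → ℝ) : Prop where
  /-- `d(·, u₀) ∈ L^∞(Ω)` for every `u₀`. -/
  memLp_top : ∀ u₀ : ℝ, MemLp (fun x => d x u₀) ∞ (volume.restrict Ω)
  /-- For almost all `x ∈ Ω`, `d(x, ·)` is monotonically non-decreasing. -/
  monotone : ∀ᵐ x ∂(volume.restrict Ω), Monotone (d x)
  /-- Equicontinuity of `d` at every `u₀`. -/
  equicontinuous : ∀ u₀ ε : ℝ, 0 < ε → ∃ δ : ℝ, 0 < δ ∧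
    ∀ u : ℝ, |u - u₀| < δ → ∀ᵐ x ∂(volume.restrict Ω), |d x u - d x u₀| < ε

/-- The cells of a simplicial complex in `ℝ^N`: the vertex sets of its `N`-dimensional simplices. -/
def cells {N : ℕ} (T : Geometry.SimplicialComplex ℝ (Space N)) : Set (Finset (Space N)) :=
  {K | K ∈ T.faces ∧ K.card = N + 1}

/-- `T` is a (conforming) simplicial mesh of `Ω`: a finite simplicial complex whose underlying
space is `closure Ω` and all of whose simplices are faces of `N`-dimensional ones. -/
structure IsMesh {N : ℕ} (Ω : Set (Space N))
    (T : Geometry.SimplicialComplex ℝ (Space N)) : Prop where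
  finite : T.faces.Finite
  space_eq : T.space = closure Ω
  pure : ∀ s ∈ T.faces, ∃ K ∈ cells T, s ⊆ K

/-- The mesh size `h`: the largest diameter of a cell. -/
def meshSize {N : ℕ} (T : Geometry.SimplicialComplex ℝ (Space N)) : ℝ :=
  sSup ((fun K : Finset (Space N) => Metric.diam (convexHull ℝ (K : Set (Space N)))) '' cells T)

/-- A family of meshes is shape-regular: every cell contains a ball whose radius is
at least a fixed fraction of the diameter of the cell. -/
def IsShapeRegular {N : ℕ} (𝓣 : Set (Geometry.SimplicialComplex ℝ (Space N))) : Prop :=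
  ∃ σ : ℝ, 0 < σ ∧ ∀ T ∈ 𝓣, ∀ K ∈ cells T, ∃ x : Space N,
    Metric.ball x (σ * Metric.diam (convexHull ℝ (K : Set (Space N)))) ⊆
      convexHull ℝ (K : Set (Space N))

/-- A family of meshes is quasi-uniform: the diameter of every cell is at least a fixed fraction
of the mesh size. -/
def IsQuasiUniform {N : ℕ} (𝓣 : Set (Geometry.SimplicialComplex ℝ (Space N))) : Prop :=
  ∃ τ : ℝ, 0 < τ ∧ ∀ T ∈ 𝓣, ∀ K ∈ cells T,
    τ * meshSize T ≤ Metric.diam (convexHull ℝ (K : Set (Space N)))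

/-- The space `V_h` of linear finite elements on the mesh `T`, vanishing on `∂Ω`: continuous
functions that are affine on every cell. A function on `closure Ω` vanishing on `∂Ω` is
represented by its extension by zero to `ℝ^N`, so that equality of functions in `V_h` is equality
on `closure Ω`. -/
def feSpace {N : ℕ} (Ω : Set (Space N)) (T : Geometry.SimplicialComplex ℝ (Space N)) :
    Submodule ℝ (Space N → ℝ) where
  carrier := {v | Continuous v ∧ (∀ x ∉ Ω, v x = 0) ∧
    ∀ K ∈ cells T, ∃ A : Space N →ᵃ[ℝ] ℝ, Set.EqOn v A (convexHull ℝ (K : Set (Space N)))}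
  add_mem' := by
    rintro v w ⟨hv, hv0, hvA⟩ ⟨hw, hw0, hwA⟩
    refine ⟨hv.add hw, fun x hx => by simp [hv0 x hx, hw0 x hx], fun K hK => ?_⟩
    obtain ⟨A, hA⟩ := hvA K hK
    obtain ⟨B, hB⟩ := hwA K hK
    exact ⟨A + B, fun x hx => by simp [hA hx, hB hx]⟩
  zero_mem' := ⟨continuous_const, fun _ _ => rfl, fun _ _ => ⟨0, fun _ _ => rfl⟩⟩
  smul_mem' := by
    rintro a v ⟨hv, hv0, hvA⟩
    refine ⟨hv.const_smul a, fun x hx => by simp [hv0 x hx], fun K hK => ?_⟩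
    obtain ⟨A, hA⟩ := hvA K hK
    exact ⟨a • A, fun x hx => by simp [hA hx]⟩

/-- `u` solves the discrete problem: `u ∈ V_h` and
`(∇u, ∇φ) + (d(u), φ) = (f, φ)` for all `φ ∈ V_h`, with the inner products of `L²(Ω)`.
A function in `V_h` is affine near every interior point of a cell; its gradient there is the
classical one, which is its weak gradient, and the remaining points of `Ω` form a null set. -/
def IsDiscreteSolution {N : ℕ} (Ω : Set (Space N)) (T : Geometry.SimplicialComplex ℝ (Space N))
    (d : Space N → ℝ → ℝ) (f : Space N → ℝ) (u : Space N → ℝ) : Prop :=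
  u ∈ feSpace Ω T ∧ ∀ φ ∈ feSpace Ω T,
    (∫ x in Ω, inner ℝ (∇ u x) (∇ φ x)) + (∫ x in Ω, d x (u x) * φ x) = ∫ x in Ω, f x * φ x

end SemilinearFEM

end

open SemilinearFEM

/-! On the finite-dimensional space $V_h$ with the Dirichlet inner product, the discrete problem
says that the residual $G(u)=(\nabla u,\nabla\cdot)+(d(u),\cdot)-(f,\cdot)$ vanishes. Since
$d(x,\cdot)$ is non-decreasing, $(G(v)-G(w))(v-w)\ge\|\nabla(v-w)\|^2$. This gives uniqueness and,
with $w=0$, the energy bound. It also gives coercivity, so existence follows from Browder–Minty,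
which needs continuity of $G$ only along rays.

The uniform constant comes from `LipschitzWith.exists_enorm_integral_mul_le`: $|\int_\Omega g v|\le
C\|g\|_{L^p}\|\nabla v\|_{L^2}$ for every Lipschitz $v$ vanishing off $\Omega$, with $C$ depending
on $N$, $\Omega$ and $p$ alone. Finite element functions, extended by zero, are such $v$. The
inequality is used for $g=f$, for $g=d(\cdot,0)$ and for $g=v$; the last makes the Dirichlet form
definite. It follows from Hölder's inequality and a Sobolev inequality, itself obtained by applying
Gagliardo–Nirenberg–Sobolev to a power $u^n$.

The assumptions on $d$ have null sets depending on the real argument; monotonicity and a countable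
cover of the line remove this dependence, so that $d(x,\cdot)$ is continuous for almost every $x$
and the nonlinear integral makes sense. -/

/-! ### Sobolev inequalities for Lipschitz functions -/

/-- A compactly supported Lipschitz function on the line is bounded by the total mass of its
derivative. -/
theorem LipschitzWith.enorm_le_lintegral_enorm_deriv {K : ℝ≥0} {g : ℝ → ℝ} (hg : LipschitzWith K g)
    (hs : HasCompactSupport g) (t : ℝ) : ‖g t‖ₑ ≤ ∫⁻ s, ‖deriv g s‖ₑ := by
  obtain ⟨a, ha⟩ : ∃ a, ∀ x ∈ tsupport g, a ≤ x := by
    obtain ⟨a, ha⟩ := (show IsCompact (tsupport g) from hs).bddBelow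
    exact ⟨a, fun x hx => ha hx⟩
  -- A point strictly left of the support and left of `t`: integrating `deriv g` from there recovers
  -- `g t`.
  have hb : g (min a t - 1) = 0 := by
    apply image_eq_zero_of_notMem_tsupport
    intro h
    have := ha _ h
    linarith [min_le_left a t]
  have hle : min a t - 1 ≤ t := by linarith [min_le_right a t]
  have h := (hg.lipschitzOnWith (s := Set.uIcc (min a t - 1) t)
    ).absolutelyContinuousOnInterval.integral_deriv_eq_sub
  rw [hb, sub_zero, intervalIntegral.integral_of_le hle] at h
  rw [← h]
  exact (enorm_integral_le_lintegral_enorm _).trans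
    (lintegral_mono' Measure.restrict_le_self le_rfl)

/-- The Gagliardo–Nirenberg–Sobolev inequality for Lipschitz functions, in coordinates. -/
theorem LipschitzWith.lintegral_pow_le_pow_lintegral_lineDeriv {ι : Type*} [Fintype ι]
    [DecidableEq ι] {p : ℝ}
    (hp : Real.HolderConjugate (Fintype.card ι) p) {K : ℝ≥0} {u : (ι → ℝ) → ℝ}
    (hu : LipschitzWith K u) (hs : HasCompactSupport u) :
    ∫⁻ x, ‖u x‖ₑ ^ p ≤ (∫⁻ x, ∑ i, ‖lineDeriv ℝ u x (Pi.single i 1)‖ₑ) ^ p := by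
  have hι : (1 : ℝ) ≤ Fintype.card ι - 1 := by
    have : (2 : ℝ) ≤ Fintype.card ι := by exact_mod_cast hp.lt
    linarith
  have hline : ∀ (x : ι → ℝ) (i : ι) (y : ℝ), deriv (fun s => u (Function.update x i s)) y =
      lineDeriv ℝ u (Function.update x i y) (Pi.single i 1) := by
    intro x i y
    have h : ∀ t : ℝ, Function.update x i y + t • (Pi.single i 1 : ι → ℝ) =
        Function.update x i (y + t) := by
      intro t
      ext j
      by_cases hj : j = i
      · subst hj; simp
      · simp [hj]
    simp only [lineDeriv, h]
    rw [deriv_comp_const_add (f := fun s => u (Function.update x i s)), add_zero]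
  -- As `p = N / (N - 1)`, the integrand splits into `N` equal factors; the `i`-th is bounded by an
  -- integral along the `i`-th coordinate line, and the grid-lines inequality finishes.
  calc ∫⁻ x, ‖u x‖ₑ ^ p
      = ∫⁻ x, ∏ _i : ι, ‖u x‖ₑ ^ (1 / (Fintype.card ι - 1 : ℝ)) := by
        congr! 2 with x
        rw [Finset.prod_const, ← ENNReal.rpow_natCast, ← ENNReal.rpow_mul, hp.conjugate_eq,
          Finset.card_univ]
        field_simp
    _ ≤ ∫⁻ x, ∏ i, (∫⁻ y, ∑ j, ‖lineDeriv ℝ u (Function.update x i y) (Pi.single j 1)‖ₑ)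
          ^ ((1 : ℝ) / (Fintype.card ι - 1 : ℝ)) := by
        gcongr with x i
        have hL : LipschitzWith K (fun s => u (Function.update x i s)) := by
          refine LipschitzWith.of_dist_le_mul fun s t => (hu.dist_le_mul _ _).trans ?_
          gcongr
          refine (dist_pi_le_iff dist_nonneg).2 fun j => ?_
          by_cases hj : j = i
          · subst hj; simp
          · simp [hj]
        have hc : HasCompactSupport (fun s => u (Function.update x i s)) :=
          hs.comp_isClosedEmbedding (Topology.IsClosedEmbedding.of_continuous_injective_isClosedMap
            (by fun_prop) (Function.update_injective x i) (isClosedEmbedding_update x i).isClosedMap)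
        have := hL.enorm_le_lintegral_enorm_deriv hc (x i)
        rw [Function.update_eq_self] at this
        refine this.trans (lintegral_mono fun y => ?_)
        rw [hline]
        exact Finset.single_le_sum (f := fun j =>
          ‖lineDeriv ℝ u (Function.update x i y) (Pi.single j 1)‖ₑ) (fun _ _ => zero_le)
          (Finset.mem_univ i)
    _ ≤ _ := by
        apply lintegral_prod_lintegral_pow_le (fun _ => volume) hp
          (f := fun x => ∑ i, ‖lineDeriv ℝ u x (Pi.single i 1)‖ₑ)
        exact Finset.measurable_fun_sum _ fun i _ => (measurable_lineDeriv hu.continuous).enorm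

/-- The Gagliardo–Nirenberg–Sobolev inequality for compactly supported Lipschitz functions on
Euclidean space. -/
theorem LipschitzWith.lintegral_pow_le_pow_lintegral_fderiv {ι : Type*} [Fintype ι] {p : ℝ}
    (hp : Real.HolderConjugate (Fintype.card ι) p) {K : ℝ≥0} {u : EuclideanSpace ℝ ι → ℝ}
    (hu : LipschitzWith K u) (hs : HasCompactSupport u) :
    ∫⁻ x, ‖u x‖ₑ ^ p ≤ (Fintype.card ι * ∫⁻ x, ‖fderiv ℝ u x‖ₑ) ^ p := by
  classical
  have hmp := PiLp.volume_preserving_toLp ι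
  set e := (EuclideanSpace.equiv ι ℝ).symm with he
  have hLv : LipschitzWith (K * ‖(e : (ι → ℝ) →L[ℝ] EuclideanSpace ℝ ι)‖₊) (u ∘ e) :=
    hu.comp (e : (ι → ℝ) →L[ℝ] EuclideanSpace ℝ ι).lipschitz
  have hcv : HasCompactSupport (u ∘ e) := hs.comp_homeomorph e.toHomeomorph
  have h := hLv.lintegral_pow_le_pow_lintegral_lineDeriv hp hcv
  have h1 : ∫⁻ x, ‖u x‖ₑ ^ p = ∫⁻ x, ‖(u ∘ e) x‖ₑ ^ p :=
    (hmp.lintegral_comp (f := fun x => ‖u x‖ₑ ^ p)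
      (hu.continuous.measurable.enorm.pow_const _)).symm
  have hm : ∀ v, Measurable fun x => ‖lineDeriv ℝ u x v‖ₑ := fun v =>
    (measurable_lineDeriv hu.continuous).enorm
  have h2 : ∫⁻ x, ∑ i, ‖lineDeriv ℝ (u ∘ e) x (Pi.single i 1)‖ₑ =
      ∫⁻ x, ∑ i, ‖lineDeriv ℝ u x (EuclideanSpace.single i 1)‖ₑ := by
    rw [← hmp.lintegral_comp (Finset.measurable_fun_sum _ fun i _ => hm _)]
    rfl
  rw [h1]
  refine h.trans (ENNReal.rpow_le_rpow ?_ hp.symm.nonneg)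
  rw [h2, ← lintegral_const_mul' _ _ (by simp)]
  refine lintegral_mono_ae ?_
  filter_upwards [hu.ae_differentiableAt (μ := volume)] with x hx
  calc ∑ i, ‖lineDeriv ℝ u x (EuclideanSpace.single i 1)‖ₑ
      ≤ ∑ _i : ι, ‖fderiv ℝ u x‖ₑ := by
        refine Finset.sum_le_sum fun i _ => ?_
        rw [hx.lineDeriv_eq_fderiv]
        refine (ContinuousLinearMap.le_opENorm _ _).trans ?_
        simp [EuclideanSpace.single, ← ofReal_norm]
    _ = _ := by simp

/-- Natural powers of bounded Lipschitz functions are Lipschitz. -/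
theorem LipschitzWith.exists_pow_of_bounded {α : Type*} [PseudoMetricSpace α] {K : ℝ≥0} {u : α → ℝ}
    (hu : LipschitzWith K u) {M : ℝ} (hM : ∀ x, |u x| ≤ M) (n : ℕ) :
    ∃ L : ℝ≥0, LipschitzWith L fun x => u x ^ n := by
  obtain ⟨L, hL⟩ := (contDiff_id (𝕜 := ℝ) (E := ℝ) (n := 1)).pow n |>.locallyLipschitz
    |>.locallyLipschitzOn (s := Set.Icc (-M) M) |>.exists_lipschitzOnWith_of_compact isCompact_Icc
  refine ⟨L * K, ?_⟩
  rw [← lipschitzOnWith_univ] at hu ⊢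
  exact hL.comp hu fun x _ => abs_le.1 (hM x)

/-- A Sobolev inequality for Lipschitz functions vanishing outside a bounded set. The exponent on
the left is `n * p` with `p` the conjugate exponent of the dimension. -/
theorem LipschitzWith.exists_eLpNorm_le_eLpNorm_fderiv {ι : Type*} [Fintype ι] {p : ℝ≥0}
    (hp : Real.HolderConjugate (Fintype.card ι) p) {n : ℕ} (hn : 2 ≤ n)
    (hnp : 2 * ((n : ℝ) - 1) ≤ n * p) {Ω : Set (EuclideanSpace ℝ ι)}
    (hΩ : Bornology.IsBounded Ω) (hΩm : MeasurableSet Ω) :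
    ∃ C : ℝ≥0, ∀ (K : ℝ≥0) (u : EuclideanSpace ℝ ι → ℝ), LipschitzWith K u → (∀ x ∉ Ω, u x = 0) →
      eLpNorm u (n * p : ℝ≥0) (volume.restrict Ω) ≤
        C * eLpNorm (fderiv ℝ u) 2 (volume.restrict Ω) := by
  set μ := volume.restrict Ω
  have hfin : volume Ω < ∞ := hΩ.measure_lt_top
  have hp1 : 1 < (p : ℝ) := hp.symm.lt
  have hp0 : p ≠ 0 := by rintro rfl; norm_num at hp1
  have hn0 : (n : ℝ) ≠ 0 := by positivity
  -- The power of the volume lost in passing from $L^{np}$ to $L^{2(n-1)}$ on `Ω`; `hnp` says that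
  -- it is nonnegative.
  set e : ℝ := 1 / (2 * (n - 1)) - 1 / (n * p)
  have he : 0 ≤ e := by
    have : (1 : ℝ) < n := by exact_mod_cast hn
    exact sub_nonneg.2 (one_div_le_one_div_of_le (by linarith) hnp)
  have : IsFiniteMeasure μ := ⟨by simpa [μ] using hfin⟩
  refine ⟨(Fintype.card ι * n * (volume Ω ^ e) ^ (n - 1)).toNNReal, fun K u hu h0 => ?_⟩
  rw [ENNReal.coe_toNNReal (ENNReal.mul_ne_top (by finiteness)
    (ENNReal.pow_ne_top (ENNReal.rpow_ne_top_of_nonneg he hfin.ne)))]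
  have hsub : tsupport u ⊆ closure Ω :=
    closure_mono fun x hx => by by_contra h; exact hx (h0 x h)
  have hs : HasCompactSupport u := hΩ.isCompact_closure.of_isClosed_subset isClosed_closure hsub
  obtain ⟨M, hM⟩ := hu.continuous.bounded_above_of_compact_support hs
  obtain ⟨L, hL⟩ := hu.exists_pow_of_bounded hM n
  have hsn : HasCompactSupport fun x => u x ^ n :=
    hs.comp_left (g := fun t : ℝ => t ^ n) (zero_pow (by omega))
  -- Since $\nabla u^n=n u^{n-1}\nabla u$, Cauchy–Schwarz turns this into $A^n\le C\,G\,A^{n-1}$,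
  -- and the finite factor $A^{n-1}$ cancels unless $A=0$.
  have hG := hL.lintegral_pow_le_pow_lintegral_fderiv hp hsn
  have hmem : MemLp u ∞ μ := memLp_top_of_bound hu.continuous.aestronglyMeasurable M
    (.of_forall hM)
  set A := eLpNorm u (n * p : ℝ≥0) μ
  have hA : A ≠ ∞ := (hmem.mono_exponent le_top).eLpNorm_ne_top
  set G := eLpNorm (fderiv ℝ u) 2 μ
  have hmu : Measurable u := hu.continuous.measurable
  have hmd : Measurable (fderiv ℝ u) := measurable_fderiv ℝ u
  have hrestr : ∀ F : EuclideanSpace ℝ ι → ℝ≥0∞, (∀ x ∉ Ω, F x = 0) → ∫⁻ x, F x = ∫⁻ x, F x ∂μ := by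
    intro F hF
    rw [← lintegral_indicator hΩm, Set.indicator_eq_self.2]
    exact fun x hx => by by_contra h; exact hx (hF x h)
  have hnp0 : (n * p : ℝ≥0) ≠ 0 := mul_ne_zero (by exact_mod_cast hn0) hp0
  have hleft : A ^ n = (∫⁻ x, ‖u x ^ n‖ₑ ^ (p : ℝ)) ^ (1 / (p : ℝ)) := by
    rw [hrestr _ fun x hx => by
      rw [h0 x hx, zero_pow (by omega), enorm_zero, ENNReal.zero_rpow_of_pos (by positivity)]]
    simp only [A]
    rw [eLpNorm_eq_lintegral_rpow_enorm_toReal (by exact_mod_cast hnp0) ENNReal.coe_ne_top,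
      ← ENNReal.rpow_natCast, ← ENNReal.rpow_mul]
    congr 1
    · refine lintegral_congr fun x => ?_
      rw [enorm_pow, ← ENNReal.rpow_natCast, ← ENNReal.rpow_mul]
      simp
    · simp
      field_simp
  have hcs : ∫⁻ x, ‖fderiv ℝ (fun x => u x ^ n) x‖ₑ ≤ n * (A * volume Ω ^ e) ^ (n - 1) * G := by
    have hn1 : 0 < (n : ℝ) - 1 := by
      have : (1 : ℝ) < n := by exact_mod_cast hn
      linarith
    have hpt : ∫⁻ x, ‖fderiv ℝ (fun x => u x ^ n) x‖ₑ ≤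
        ∫⁻ x, n * (‖u x‖ₑ ^ ((n : ℝ) - 1) * ‖fderiv ℝ u x‖ₑ) := by
      refine lintegral_mono_ae ?_
      filter_upwards [hu.ae_differentiableAt (μ := volume)] with x hx
      rw [(hx.hasFDerivAt.pow n).fderiv, enorm_smul, nsmul_eq_mul, enorm_mul, enorm_pow, ← mul_assoc,
        ← ENNReal.rpow_natCast, Nat.cast_sub (by omega), Nat.cast_one]
      simp [← ofReal_norm]
    refine hpt.trans ?_
    rw [hrestr _ fun x hx => by
      rw [h0 x hx, enorm_zero, ENNReal.zero_rpow_of_pos hn1, zero_mul, mul_zero],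
      lintegral_const_mul' _ _ (by simp), mul_assoc]
    gcongr
    refine (ENNReal.lintegral_mul_le_Lp_mul_Lq μ Real.HolderConjugate.two_two
      (hmu.enorm.pow_const _).aemeasurable hmd.enorm.aemeasurable).trans ?_
    have hG2 : (∫⁻ a, ‖fderiv ℝ u a‖ₑ ^ (2 : ℝ) ∂μ) ^ (1 / (2 : ℝ)) = G := by
      simp only [G]
      rw [eLpNorm_eq_lintegral_rpow_enorm_toReal (by simp) (by simp)]
      simp
    rw [hG2]
    gcongr
    have h2 := eLpNorm_enorm_rpow (p := 2) (μ := μ) u hn1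
    rw [eLpNorm_eq_lintegral_rpow_enorm_toReal (by simp) (by simp)] at h2
    simp only [enorm_eq_self, ENNReal.toReal_ofNat] at h2
    rw [h2, ← ENNReal.rpow_natCast, Nat.cast_sub (by omega), Nat.cast_one]
    refine ENNReal.rpow_le_rpow ?_ hn1.le
    refine (eLpNorm_le_eLpNorm_mul_rpow_measure_univ (q := (n * p : ℝ≥0)) ?_
      hu.continuous.aestronglyMeasurable).trans (le_of_eq ?_)
    · rw [← ENNReal.ofReal_ofNat, ← ENNReal.ofReal_mul (by norm_num), ENNReal.ofReal_le_iff_le_toReal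
        ENNReal.coe_ne_top]
      simpa using hnp
    · rw [Measure.restrict_apply_univ, ENNReal.toReal_mul, ENNReal.toReal_ofReal hn1.le]
      simp [A, e]
  have hmain : A ^ n ≤ Fintype.card ι * n * (volume Ω ^ e) ^ (n - 1) * G * A ^ (n - 1) := by
    rw [hleft]
    refine (ENNReal.rpow_le_rpow hG (by positivity)).trans ?_
    rw [← ENNReal.rpow_mul, mul_one_div_cancel (by positivity), ENNReal.rpow_one]
    refine (mul_le_mul_right hcs _).trans (le_of_eq ?_)
    rw [mul_pow]
    ring
  by_cases hA0 : A = 0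
  · rw [hA0]; exact zero_le
  · have hn' : n = n - 1 + 1 := by omega
    rw [hn', pow_succ, mul_comm, ← hn'] at hmain
    exact (ENNReal.mul_le_mul_iff_left (pow_ne_zero _ hA0) (ENNReal.pow_ne_top hA)).1 hmain

/-! ### Browder–Minty in finite dimension -/

/-- For a monotone map `F` from a convex compact set to the dual space, finitely many of the
inequalities `0 ≤ ⟨F v, v - u⟩` have a common solution `u`. -/
theorem exists_forall_mem_finset_nonneg_of_monotone {E : Type*} [AddCommGroup E] [Module ℝ E]
    [TopologicalSpace E] [IsTopologicalAddGroup E] [ContinuousSMul ℝ E] [T2Space E]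
    [FiniteDimensional ℝ E] {K : Set E}
    (hK : IsCompact K) (hc : Convex ℝ K) (hne : K.Nonempty) {G : E → E →ₗ[ℝ] ℝ}
    (hG : ∀ v w, 0 ≤ (G v - G w) (v - w)) (t : Finset E) (ht : ∀ v ∈ t, v ∈ K) :
    ∃ u ∈ K, ∀ v ∈ t, 0 ≤ G v (v - u) := by
  classical
  by_contra! hcon
  -- the image of `K` under `u ↦ (G v (v - u))_v` and the nonnegative orthant
  let Φ : E →ᵃ[ℝ] (t → ℝ) := AffineMap.pi fun v : t =>
    (AffineMap.const ℝ E (G v v) - (G v).toAffineMap)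
  have hΦ : ∀ u (v : t), Φ u v = G v (v - u) := fun u v => by simp [Φ, map_sub]
  have hΦc : Continuous Φ := by
    refine continuous_pi fun v => ?_
    simp only [hΦ]
    exact (LinearMap.continuous_of_finiteDimensional (G v)).comp (by fun_prop)
  have hdisj : Disjoint (Φ '' K) (Set.Ici 0) := by
    rw [Set.disjoint_left]
    rintro _ ⟨u, hu, rfl⟩ h0
    obtain ⟨v, hv, hlt⟩ := hcon u hu
    exact absurd (h0 ⟨v, hv⟩) (by rw [hΦ]; simpa using hlt)
  obtain ⟨φ, a, b, ha, hab, hb⟩ := geometric_hahn_banach_compact_closed (hc.affine_image Φ)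
    (hK.image hΦc) (convex_Ici 0) isClosed_Ici hdisj
  have hb0 : b < 0 := by simpa using hb 0 (by simp)
  set c : t → ℝ := fun v => φ (Pi.single v 1) with hcdef
  have hφ : ∀ y, φ y = ∑ v, y v * c v := by
    intro y
    conv_lhs => rw [← Finset.univ_sum_single y, map_sum]
    refine Finset.sum_congr rfl fun v _ => ?_
    have : Pi.single v (y v) = y v • (Pi.single v 1 : t → ℝ) := by
      rw [← Pi.single_smul]; simp
    rw [this, map_smul, smul_eq_mul]
  -- A negative weight would allow the point `(b / c v) • Pi.single v 1` of the orthant, where `φ`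
  -- equals `b` exactly.
  have hc0 : ∀ v, 0 ≤ c v := by
    intro v
    by_contra! h
    have h1 := hb ((b / c v) • Pi.single v 1) (by
      rw [Set.mem_Ici, Pi.le_def]
      intro j
      by_cases hj : j = v
      · subst hj
        simpa using div_nonneg_of_nonpos hb0.le h.le
      · simp [hj])
    rw [map_smul, smul_eq_mul] at h1
    change b < b / c v * c v at h1
    rw [div_mul_cancel₀ _ h.ne] at h1
    exact lt_irrefl _ h1
  have hneg : ∀ u ∈ K, ∑ v : t, G v (v - u) * c v < 0 := by
    intro u hu
    have := ha _ (Set.mem_image_of_mem Φ hu)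
    rw [hφ] at this
    simp only [hΦ] at this
    linarith
  have hs : 0 < ∑ v, c v := by
    refine (Finset.sum_nonneg fun v _ => hc0 v).lt_of_ne fun h => ?_
    have h0 := (Finset.sum_eq_zero_iff_of_nonneg fun v _ => hc0 v).1 h.symm
    obtain ⟨u, hu⟩ := hne
    refine absurd (hneg u hu) (not_lt.2 (le_of_eq ?_))
    exact (Finset.sum_eq_zero fun v hv => by rw [h0 v hv, mul_zero]).symm
  set S := ∑ v, c v with hS
  -- The barycentre for the separating weights is the point of `K` at which separation contradicts
  -- monotonicity.
  set u : E := ∑ v : t, (c v / S) • (v : E) with hu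
  have huK : u ∈ K := by
    refine hc.sum_mem (fun v _ => div_nonneg (hc0 v) hs.le) ?_ fun v _ => ht v v.2
    rw [← Finset.sum_div, div_self hs.ne']
  have hlt := hneg u huK
  have hexp : ∑ v : t, G v (v - u) * c v = S⁻¹ * ∑ v : t, ∑ w : t, c v * c w * G v (v - w) := by
    rw [Finset.mul_sum]
    refine Finset.sum_congr rfl fun v _ => ?_
    have : (v : E) - u = ∑ w : t, (c w / S) • ((v : E) - w) := by
      simp only [smul_sub, Finset.sum_sub_distrib, ← Finset.sum_smul, ← Finset.sum_div]
      rw [← hS, div_self hs.ne', one_smul]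
    rw [this, map_sum, Finset.sum_mul, Finset.mul_sum]
    refine Finset.sum_congr rfl fun w _ => ?_
    rw [map_smul, smul_eq_mul]
    field_simp
  -- Swapping `v` and `w` and adding gives twice the sum, now with `G v - G w` in place of `G v`.
  have hsym : 0 ≤ ∑ v : t, ∑ w : t, c v * c w * G v (v - w) := by
    have h1 : ∑ v : t, ∑ w : t, c v * c w * G v (v - w) =
        ∑ v : t, ∑ w : t, c v * c w * G w (w - v) := by
      rw [Finset.sum_comm]
      exact Finset.sum_congr rfl fun v _ => Finset.sum_congr rfl fun w _ => by ring
    have h2 : 0 ≤ ∑ v : t, ∑ w : t, c v * c w * (G v - G w) (v - w) :=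
      Finset.sum_nonneg fun v _ => Finset.sum_nonneg fun w _ =>
        mul_nonneg (mul_nonneg (hc0 v) (hc0 w)) (hG v w)
    have h3 : ∑ v : t, ∑ w : t, c v * c w * (G v - G w) (v - w) =
        ∑ v : t, ∑ w : t, c v * c w * G v (v - w) + ∑ v : t, ∑ w : t, c v * c w * G w (w - v) := by
      simp only [← Finset.sum_add_distrib]
      refine Finset.sum_congr rfl fun v _ => Finset.sum_congr rfl fun w _ => ?_
      rw [LinearMap.sub_apply, ← neg_sub (v : E) w, map_neg]
      ring
    linarith
  rw [hexp] at hlt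
  exact absurd hlt (not_lt.2 (mul_nonneg (inv_nonneg.2 hs.le) hsym))

/-- **Browder–Minty** in finite dimension: a monotone, hemicontinuous map to the dual space which
points outwards on a sphere has a zero. -/
theorem exists_eq_zero_of_monotone_of_hemicontinuous {E : Type*} [NormedAddCommGroup E]
    [NormedSpace ℝ E] [FiniteDimensional ℝ E] {G : E → E →ₗ[ℝ] ℝ}
    (hG : ∀ v w, 0 ≤ (G v - G w) (v - w))
    (hcont : ∀ u w, Filter.Tendsto (fun t : ℝ => G (u + t • w) w) (nhdsWithin 0 (Set.Ioi 0))
      (nhds (G u w)))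
    {R : ℝ} (hR : 0 < R) (hcoer : ∀ v, ‖v‖ = R → 0 < G v v) : ∃ u, G u = 0 := by
  have : ProperSpace E := FiniteDimensional.proper ℝ E
  set K := Metric.closedBall (0 : E) R
  have hK : IsCompact K := isCompact_closedBall _ _
  have hc : Convex ℝ K := convex_closedBall _ _
  -- With `G` evaluated at `v` and not at `u`, each condition is closed in `u`, so the finite
  -- intersection property applies without continuity of `G`.
  obtain ⟨u, hu, hvi⟩ : ∃ u ∈ K, ∀ v ∈ K, 0 ≤ G v (v - u) := by
    have h := hK.inter_iInter_nonempty (fun v : K => {u | 0 ≤ G v (v - u)})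
      (fun v => isClosed_le continuous_const
        ((LinearMap.continuous_of_finiteDimensional (G v)).comp (by fun_prop)))
      (fun t => by
        classical
        obtain ⟨u, hu, h⟩ := exists_forall_mem_finset_nonneg_of_monotone hK hc
          ⟨0, Metric.mem_closedBall_self hR.le⟩ hG (t.image Subtype.val)
          (fun v hv => by obtain ⟨w, -, rfl⟩ := Finset.mem_image.1 hv; exact w.2)
        refine ⟨u, hu, ?_⟩
        simp only [Set.mem_iInter, Set.mem_ofPred_eq]
        exact fun v hv => h v (Finset.mem_image_of_mem _ hv))
    obtain ⟨u, hu, h⟩ := h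
    simp only [Set.mem_iInter, Set.mem_ofPred_eq] at h
    exact ⟨u, hu, fun v hv => h ⟨v, hv⟩⟩
  -- Minty's trick: test with `u + t • (w - u)`, divide by `t`, and let `t` decrease to `0`.
  have hmin : ∀ w ∈ K, 0 ≤ G u (w - u) := by
    intro w hw
    refine ge_of_tendsto (hcont u (w - u)) ?_
    filter_upwards [Ioc_mem_nhdsGT one_pos] with t ht
    have h := hvi _ (hc.add_smul_sub_mem hu hw ⟨ht.1.le, ht.2⟩)
    rw [add_sub_cancel_left, map_smul, smul_eq_mul] at h
    exact nonneg_of_mul_nonneg_right h ht.1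
  have hlt : ‖u‖ < R := by
    refine lt_of_le_of_ne (by simpa [K] using hu) fun h => ?_
    have := hmin 0 (Metric.mem_closedBall_self hR.le)
    rw [zero_sub, map_neg] at this
    linarith [hcoer u h]
  refine ⟨u, ?_⟩
  have hge : ∀ w, 0 ≤ G u w := by
    intro w
    have hball : ∀ᶠ t : ℝ in nhdsWithin 0 (Set.Ioi 0), u + t • w ∈ K := by
      refine nhdsWithin_le_nhds ?_
      have hcw : Continuous fun t : ℝ => u + t • w := by fun_prop
      refine hcw.continuousAt.preimage_mem_nhds (Metric.closedBall_mem_nhds_of_mem ?_)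
      simpa using hlt
    obtain ⟨t, ht, ht0⟩ := (hball.and self_mem_nhdsWithin).exists
    have h := hmin _ ht
    rw [add_sub_cancel_left, map_smul, smul_eq_mul] at h
    exact nonneg_of_mul_nonneg_right h ht0
  ext w
  refine le_antisymm ?_ (hge w)
  have := hge (-w)
  rw [map_neg] at this
  simpa using this

/-! ### Lipschitz continuity from local and piecewise bounds -/

open Filter Topology in
/-- A continuous function which is pointwise Lipschitz at every point, with a uniform constant,
is Lipschitz. -/
theorem lipschitzWith_of_forall_eventually_norm_sub_le {E F : Type*} [NormedAddCommGroup E]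
    [NormedSpace ℝ E] [NormedAddCommGroup F] {v : E → F} {L : ℝ≥0}
    (hv : Continuous v) (h : ∀ x, ∀ᶠ z in 𝓝 x, ‖v z - v x‖ ≤ L * ‖z - x‖) :
    LipschitzWith L v := by
  refine LipschitzWith.of_dist_le_mul fun y x => ?_
  rw [dist_eq_norm, dist_eq_norm]
  set γ : ℝ → E := fun t => x + t • (y - x) with hγ
  have hγc : Continuous γ := by fun_prop
  -- Along the segment from `x` to `y` the right slopes of the increment are at most `L * ‖y - x‖`,
  -- so a mean value inequality without derivatives applies.
  have hmain := image_le_of_liminf_slope_right_le_deriv_boundary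
    (f := fun t => ‖v (γ t) - v x‖) (a := 0) (b := 1)
    (B := fun t => L * ‖y - x‖ * t) (B' := fun _ => L * ‖y - x‖)
    (by fun_prop) (by simp [hγ]) (by fun_prop)
    (fun t _ => by simpa using ((hasDerivAt_id t).const_mul (L * ‖y - x‖)).hasDerivWithinAt)
    (fun t _ r hr => by
      have hev : ∀ᶠ z in 𝓝[>] t, ‖v (γ z) - v (γ t)‖ ≤ L * ‖γ z - γ t‖ :=
        nhdsWithin_le_nhds (hγc.continuousAt.eventually (h (γ t)))
      refine Eventually.frequently ?_
      filter_upwards [hev, self_mem_nhdsWithin] with z hz hzt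
      have hzt' : 0 < z - t := sub_pos.2 hzt
      refine lt_of_le_of_lt ?_ hr
      rw [slope_def_field, div_le_iff₀ hzt']
      have h1 : γ z - γ t = (z - t) • (y - x) := by simp only [hγ]; module
      rw [h1, norm_smul, Real.norm_of_nonneg hzt'.le] at hz
      have h2 := norm_sub_norm_le (v (γ z) - v x) (v (γ t) - v x)
      rw [sub_sub_sub_cancel_right] at h2
      linarith)
  simpa [hγ] using hmain (Set.right_mem_Icc.2 zero_le_one)

/-- A continuous function which is Lipschitz on each set of a finite closed cover is Lipschitz. -/
theorem exists_lipschitzWith_of_finite_closed_cover {E F : Type*} [NormedAddCommGroup E]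
    [NormedSpace ℝ E] [NormedAddCommGroup F] {v : E → F} (hv : Continuous v) {𝒞 : Set (Set E)}
    (hfin : 𝒞.Finite) (hcl : ∀ C ∈ 𝒞, IsClosed C) (hcov : ⋃₀ 𝒞 = Set.univ)
    (hL : ∀ C ∈ 𝒞, ∃ L, LipschitzOnWith L v C) : ∃ L, LipschitzWith L v := by
  choose! L hL using hL
  obtain ⟨M, hM⟩ := (hfin.image L).bddAbove
  refine ⟨M, lipschitzWith_of_forall_eventually_norm_sub_le hv fun x => ?_⟩
  -- Finiteness keeps the members missing `x` away from `x`: every nearby point shares a member with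
  -- `x`.
  have hcl' : IsClosed (⋃₀ {C ∈ 𝒞 | x ∉ C}) := by
    rw [Set.sUnion_eq_biUnion]
    exact (hfin.subset (Set.sep_subset _ _)).isClosed_biUnion fun C hC => hcl C hC.1
  have hx : x ∈ (⋃₀ {C ∈ 𝒞 | x ∉ C})ᶜ := by
    rintro ⟨C, hC, hxC⟩
    exact hC.2 hxC
  filter_upwards [hcl'.isOpen_compl.mem_nhds hx] with z hz
  obtain ⟨C, hC, hzC⟩ : z ∈ ⋃₀ 𝒞 := hcov ▸ Set.mem_univ z
  have hxC : x ∈ C := by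
    by_contra hn
    exact hz ⟨C, ⟨hC, hn⟩, hzC⟩
  have h := (hL C hC).dist_le_mul z hzC x hxC
  rw [dist_eq_norm, dist_eq_norm] at h
  refine h.trans ?_
  gcongr
  exact hM (Set.mem_image_of_mem L hC)

/-! ### Finite element functions -/

namespace SemilinearFEM

variable {N : ℕ} {Ω : Set (Space N)} {T : Geometry.SimplicialComplex ℝ (Space N)}

theorem IsMesh.finite_cells (hT : IsMesh Ω T) : (cells T).Finite :=
  hT.finite.subset fun _ h => h.1

theorem IsMesh.exists_cell (hT : IsMesh Ω T) {x : Space N} (hx : x ∈ Ω) :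
    ∃ K ∈ cells T, x ∈ convexHull ℝ (K : Set (Space N)) := by
  have h : x ∈ T.space := hT.space_eq ▸ subset_closure hx
  obtain ⟨s, hs, hxs⟩ := Geometry.SimplicialComplex.mem_space_iff.1 h
  obtain ⟨K, hK, hsK⟩ := hT.pure s hs
  exact ⟨K, hK, convexHull_mono (by exact_mod_cast hsK) hxs⟩

/-- Finite element functions are Lipschitz. -/
theorem IsMesh.exists_lipschitzWith (hT : IsMesh Ω T) (hΩ : IsOpen Ω) {v : Space N → ℝ}
    (hv : v ∈ feSpace Ω T) : ∃ L, LipschitzWith L v := by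
  obtain ⟨hc, h0, hA⟩ := hv
  -- Adding `Ωᶜ`, where `v` is zero, to the cells makes a finite closed cover of the whole space.
  refine exists_lipschitzWith_of_finite_closed_cover hc
    (𝒞 := insert Ωᶜ ((fun K : Finset (Space N) => convexHull ℝ (K : Set (Space N))) '' cells T))
    ((hT.finite_cells.image _).insert _) ?_ ?_ ?_
  · rintro C (rfl | ⟨K, -, rfl⟩)
    · exact hΩ.isClosed_compl
    · exact (K.finite_toSet.isCompact_convexHull (𝕜 := ℝ)).isClosed
  · refine Set.eq_univ_of_forall fun x => ?_
    by_cases hx : x ∈ Ω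
    · obtain ⟨K, hK, hxK⟩ := hT.exists_cell hx
      exact ⟨_, Or.inr ⟨K, hK, rfl⟩, hxK⟩
    · exact ⟨_, Or.inl rfl, hx⟩
  · rintro C (rfl | ⟨K, hK, rfl⟩)
    · exact ⟨0, fun x hx y hy => by simp [h0 x hx, h0 y hy]⟩
    · obtain ⟨A, hA⟩ := hA K hK
      refine ⟨‖A.linear.toContinuousLinearMap‖₊, LipschitzOnWith.of_dist_le_mul fun x hx y hy => ?_⟩
      rw [hA hx, hA hy, dist_eq_norm, dist_eq_norm, ← vsub_eq_sub (A x), ← A.linearMap_vsub]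
      exact A.linear.toContinuousLinearMap.le_opNorm _

/-- The finite element space is finite-dimensional. -/
theorem IsMesh.finiteDimensional_feSpace (hT : IsMesh Ω T) :
    FiniteDimensional ℝ (feSpace Ω T) := by
  set S : Set (Space N) := ⋃ K ∈ cells T, (K : Set (Space N))
  have : Finite S := (hT.finite_cells.biUnion fun K _ => K.finite_toSet).to_subtype
  have := Fintype.ofFinite S
  -- Evaluation at the finitely many vertices is injective.
  refine FiniteDimensional.of_injective
    ((LinearMap.funLeft ℝ ℝ (Subtype.val : S → Space N)).comp (feSpace Ω T).subtype) ?_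
  rw [injective_iff_map_eq_zero]
  rintro ⟨v, hc, h0, hA⟩ hv
  ext x
  change v x = 0
  by_cases hx : x ∈ Ω
  · obtain ⟨K, hK, hxK⟩ := hT.exists_cell hx
    obtain ⟨A, hA⟩ := hA K hK
    rw [hA hxK]
    refine convexHull_min (t := A ⁻¹' {0}) (fun y hy => ?_)
      ((convex_singleton (0 : ℝ)).affine_preimage A) hxK
    rw [Set.mem_preimage, ← hA (subset_convexHull ℝ _ hy)]
    exact congrFun hv ⟨y, Set.mem_biUnion hK hy⟩
  · exact h0 x hx

end SemilinearFEM

/-! ### Browder–Minty for an inner product on a bare vector space -/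

/-- **Browder–Minty** in finite dimension, with coercivity measured by an inner product. -/
theorem InnerProductSpace.Core.exists_eq_zero_of_monotone {E : Type*} [AddCommGroup E] [Module ℝ E]
    [FiniteDimensional ℝ E] (core : InnerProductSpace.Core ℝ E) {G : E → E →ₗ[ℝ] ℝ}
    (hG : ∀ v w, 0 ≤ (G v - G w) (v - w))
    (hcont : ∀ u w, Filter.Tendsto (fun t : ℝ => G (u + t • w) w) (nhdsWithin 0 (Set.Ioi 0))
      (nhds (G u w)))
    {R : ℝ} (hR : 0 < R) (hcoer : ∀ v, √(core.inner v v) = R → 0 < G v v) : ∃ u, G u = 0 := by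
  let : NormedAddCommGroup E := core.toNormedAddCommGroup
  let : InnerProductSpace ℝ E := InnerProductSpace.ofCore core.toCore
  exact exists_eq_zero_of_monotone_of_hemicontinuous hG hcont hR hcoer

/-! ### Gradients -/

section Gradient

variable {E : Type*} [NormedAddCommGroup E] [InnerProductSpace ℝ E] [CompleteSpace E]

theorem enorm_gradient (v : E → ℝ) (x : E) : ‖∇ v x‖ₑ = ‖fderiv ℝ v x‖ₑ := by
  rw [gradient, LinearIsometryEquiv.enorm_map]

theorem LipschitzWith.norm_gradient_le {v : E → ℝ} {L : ℝ≥0} (hv : LipschitzWith L v) (x : E) :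
    ‖∇ v x‖ ≤ L := by
  rw [gradient, LinearIsometryEquiv.norm_map]
  exact norm_fderiv_le_of_lipschitz ℝ hv

theorem gradient_add_apply {v w : E → ℝ} {x : E} (hv : DifferentiableAt ℝ v x)
    (hw : DifferentiableAt ℝ w x) : ∇ (v + w) x = ∇ v x + ∇ w x := by
  simp only [gradient]
  rw [fderiv_add hv hw, map_add]

theorem gradient_const_smul_apply {v : E → ℝ} {x : E} (hv : DifferentiableAt ℝ v x) (a : ℝ) :
    ∇ (a • v) x = a • ∇ v x := by
  simp only [gradient]
  rw [fderiv_const_smul hv, map_smul]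

theorem measurable_gradient [MeasurableSpace E] [BorelSpace E] [FiniteDimensional ℝ E] (v : E → ℝ) :
    Measurable (∇ v) := by
  exact (InnerProductSpace.toDual ℝ E).symm.continuous.measurable.comp (measurable_fderiv ℝ v)

end Gradient

/-! ### The superposition operator of the nonlinearity -/

namespace SemilinearFEM.NonlinearityAssumption

open Filter Topology

variable {N : ℕ} {Ω : Set (Space N)} {d : Space N → ℝ → ℝ}

/-- Monotonicity squeezes `d x u` between the values at `u₀ ± δ / 2`, so finitely many null sets
serve all `u` near `u₀`. -/
theorem exists_forall_abs_sub_lt (hd : NonlinearityAssumption Ω d) (u₀ : ℝ) {ε : ℝ} (hε : 0 < ε) :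
    ∃ δ > 0, ∀ᵐ x ∂volume.restrict Ω, ∀ u, |u - u₀| < δ → |d x u - d x u₀| < ε := by
  obtain ⟨δ, hδ, h⟩ := hd.equicontinuous u₀ ε hε
  refine ⟨δ / 2, by positivity, ?_⟩
  filter_upwards [hd.monotone, h (u₀ + δ / 2) (by rw [abs_lt]; constructor <;> linarith),
    h (u₀ - δ / 2) (by rw [abs_lt]; constructor <;> linarith)] with x hm h1 h2 u hu
  rw [abs_lt] at *
  have h3 := hm (show u ≤ u₀ + δ / 2 by linarith)
  have h4 := hm (show u₀ - δ / 2 ≤ u by linarith)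
  constructor <;> linarith

/-- The null set outside which `d(x, ·)` is continuous at `u₀` can be chosen independently
of `u₀`. -/
theorem ae_continuous (hd : NonlinearityAssumption Ω d) :
    ∀ᵐ x ∂volume.restrict Ω, Continuous (d x) := by
  have h : ∀ (n : ℕ) (u₀ : ℝ), ∃ δ > 0, ∀ᵐ x ∂volume.restrict Ω, ∀ u, |u - u₀| < δ →
      |d x u - d x u₀| < 1 / ((n : ℝ) + 1) :=
    fun n u₀ => hd.exists_forall_abs_sub_lt u₀ Nat.one_div_pos_of_nat
  choose δ hδ h using h
  -- Lindelöf: for each `n` countably many balls cover the line, so only countably many null sets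
  -- are discarded.
  choose s hs hcov using fun n => TopologicalSpace.countable_cover_nhds
    (f := fun u₀ => Metric.ball u₀ (δ n u₀)) fun u₀ => Metric.ball_mem_nhds u₀ (hδ n u₀)
  have hall : ∀ᵐ x ∂volume.restrict Ω, ∀ n, ∀ u₀ ∈ s n, ∀ u, |u - u₀| < δ n u₀ →
      |d x u - d x u₀| < 1 / ((n : ℝ) + 1) :=
    ae_all_iff.2 fun n => (ae_ball_iff (hs n)).2 fun u₀ _ => h n u₀
  filter_upwards [hall] with x hx
  refine continuous_iff_continuousAt.2 fun u => Metric.tendsto_nhds.2 fun ε hε => ?_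
  obtain ⟨n, hn⟩ := exists_nat_one_div_lt (half_pos hε)
  obtain ⟨u₀, hu₀, hu⟩ := Set.mem_iUnion₂.1 (hcov n ▸ Set.mem_univ u)
  filter_upwards [Metric.isOpen_ball.mem_nhds hu] with w hw
  have h1 := abs_lt.1 (hx n u₀ hu₀ w (by rwa [Metric.mem_ball, Real.dist_eq] at hw))
  have h2 := abs_lt.1 (hx n u₀ hu₀ u (by rwa [Metric.mem_ball, Real.dist_eq] at hu))
  rw [Real.dist_eq, abs_lt]
  constructor <;> linarith

/-- For simple `v` the composition is a finite sum of functions `d · c` cut off to level sets;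
continuity of `d x` carries measurability to the limit. -/
theorem aestronglyMeasurable_comp (hd : NonlinearityAssumption Ω d) {v : Space N → ℝ}
    (hv : Measurable v) : AEStronglyMeasurable (fun x => d x (v x)) (volume.restrict Ω) := by
  set s := hv.stronglyMeasurable.approx
  refine aestronglyMeasurable_of_tendsto_ae atTop (f := fun n x => d x (s n x)) (fun n => ?_) ?_
  · have hsum : (fun x => d x (s n x)) = ∑ c ∈ (s n).range,
        (s n ⁻¹' {c}).indicator fun x => d x c := by
      ext x
      rw [Finset.sum_apply, Finset.sum_eq_single (s n x)]
      · simp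
      · exact fun c _ hc => Set.indicator_of_notMem (fun h => hc h.symm) _
      · exact fun h => (h (SimpleFunc.mem_range_self _ _)).elim
    rw [hsum]
    exact Finset.aestronglyMeasurable_sum _ fun c _ =>
      (hd.memLp_top c).aestronglyMeasurable.indicator ((s n).measurableSet_fiber c)
  · filter_upwards [hd.ae_continuous] with x hx
    exact (hx.tendsto _).comp (hv.stronglyMeasurable.tendsto_approx x)

/-- By monotonicity the two values at `±M` control everything between them. -/
theorem exists_forall_abs_le (hd : NonlinearityAssumption Ω d) (M : ℝ) :
    ∃ C : ℝ, ∀ᵐ x ∂volume.restrict Ω, ∀ u, |u| ≤ M → |d x u| ≤ C := by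
  have h : ∀ c, ∃ C : ℝ, ∀ᵐ x ∂volume.restrict Ω, |d x c| ≤ C := fun c => by
    refine ⟨(eLpNorm (fun x => d x c) ∞ (volume.restrict Ω)).toReal, ?_⟩
    filter_upwards [ae_le_eLpNormEssSup (f := fun x => d x c) (μ := volume.restrict Ω)] with x hx
    have := ENNReal.toReal_mono (hd.memLp_top c).eLpNorm_ne_top (by simpa using hx)
    simpa using this
  obtain ⟨C, hC⟩ := h M
  obtain ⟨C', hC'⟩ := h (-M)
  refine ⟨max C C', ?_⟩
  filter_upwards [hd.monotone, hC, hC'] with x hm h1 h2 u hu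
  rw [abs_le] at hu
  exact abs_le_max_abs_abs (hm hu.1) (hm hu.2) |>.trans (by rw [max_comm]; exact max_le_max h1 h2)

end SemilinearFEM.NonlinearityAssumption

/-! ### The dual estimate for data in $L^p$ -/

/-- Duality form of the Sobolev inequality: a function in `L^p`, `p > N / 2`, acts boundedly on
Lipschitz functions vanishing outside a bounded set with respect to the norm of the gradient. -/
theorem LipschitzWith.exists_enorm_integral_mul_le {N : ℕ} (hN : N = 2 ∨ N = 3)
    {Ω : Set (EuclideanSpace ℝ (Fin N))} (hb : Bornology.IsBounded Ω) (hm : MeasurableSet Ω)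
    {p : ℝ≥0∞} (hp : (N : ℝ≥0∞) / 2 < p) :
    ∃ C : ℝ≥0, ∀ (K : ℝ≥0) (u : EuclideanSpace ℝ (Fin N) → ℝ), LipschitzWith K u →
      (∀ x ∉ Ω, u x = 0) → ∀ g, MemLp g p (volume.restrict Ω) →
        ‖∫ x in Ω, g x * u x‖ₑ ≤
          C * eLpNorm g p (volume.restrict Ω) * eLpNorm (∇ u) 2 (volume.restrict Ω) := by
  set μ := volume.restrict Ω
  have hfin : volume Ω < ∞ := hb.measure_lt_top
  have : IsFiniteMeasure μ := ⟨by simpa [μ] using hfin⟩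
  -- A finite `r` between `N / 2` and `p` has a real conjugate exponent, also when `p = ∞`.
  obtain ⟨r, hr, hrp⟩ := ENNReal.lt_iff_exists_nnreal_btwn.1 hp
  have hr' : (N : ℝ) / 2 < r := by
    have := (ENNReal.toReal_lt_toReal (by finiteness) ENNReal.coe_ne_top).2 hr
    simpa using this
  have hr1 : (1 : ℝ) < r := by
    refine lt_of_le_of_lt ?_ hr'
    rcases hN with rfl | rfl <;> norm_num
  set s := Real.conjExponent r with hs
  have hrs : Real.HolderConjugate r s := .conjExponent hr1
  -- The Sobolev exponent `n * P` must reach `s`. For `N = 2`, `P = 2` and `n` may be as large as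
  -- needed; for `N = 3`, `n * P = 3` is conjugate to `3 / 2 < r`.
  obtain ⟨P, n, hP, hn, hnP, hsn⟩ : ∃ (P : ℝ≥0) (n : ℕ), Real.HolderConjugate (N : ℝ) P ∧ 2 ≤ n ∧
      2 * ((n : ℝ) - 1) ≤ n * P ∧ s ≤ n * P := by
    rcases hN with rfl | rfl
    · obtain ⟨m, hm⟩ := exists_nat_ge s
      refine ⟨2, max 2 m, ?_, le_max_left _ _, ?_, ?_⟩
      · rw [Real.holderConjugate_iff]; norm_num
      · rw [NNReal.coe_ofNat]; linarith
      · have h1 : (m : ℝ) ≤ (max 2 m : ℕ) := by exact_mod_cast le_max_right _ _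
        rw [NNReal.coe_ofNat]
        linarith [hrs.symm.pos]
    · refine ⟨3 / 2, 2, ?_, le_rfl, ?_, ?_⟩
      · rw [Real.holderConjugate_iff]; norm_num
      · norm_num
      · rw [hs, Real.conjExponent, div_le_iff₀ (by linarith)]
        norm_num at hr' ⊢
        linarith
  have hs0 : 0 < s := hrs.symm.pos
  obtain ⟨C, hC⟩ := LipschitzWith.exists_eLpNorm_le_eLpNorm_fderiv (ι := Fin N)
    (by rwa [Fintype.card_fin]) hn hnP hb hm
  have he₁ : 0 ≤ 1 / (r : ℝ) - 1 / p.toReal := by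
    rcases eq_or_ne p ∞ with rfl | hp'
    · simp
    · exact sub_nonneg.2 (one_div_le_one_div_of_le (by linarith)
        (by simpa using ENNReal.toReal_mono hp' hrp.le))
  have he₂ : 0 ≤ 1 / s - 1 / (n * P : ℝ) :=
    sub_nonneg.2 (one_div_le_one_div_of_le hs0 hsn)
  set c₁ := volume Ω ^ (1 / (r : ℝ) - 1 / p.toReal)
  set c₂ := volume Ω ^ (1 / s - 1 / (n * P : ℝ))
  have hc₁ : c₁ ≠ ∞ := ENNReal.rpow_ne_top_of_nonneg he₁ hfin.ne
  have hc₂ : c₂ ≠ ∞ := ENNReal.rpow_ne_top_of_nonneg he₂ hfin.ne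
  refine ⟨(c₁ * c₂ * C).toNNReal, fun K u hu h0 g hg => ?_⟩
  rw [ENNReal.coe_toNNReal (by finiteness)]
  have hum : AEStronglyMeasurable u μ := hu.continuous.aestronglyMeasurable
  have hgr : eLpNorm g r μ ≤ eLpNorm g p μ * c₁ := by
    simpa [μ, c₁] using eLpNorm_le_eLpNorm_mul_rpow_measure_univ hrp.le hg.aestronglyMeasurable
  have hus : eLpNorm u (ENNReal.ofReal s) μ ≤ eLpNorm u (n * P : ℝ≥0) μ * c₂ := by
    have := eLpNorm_le_eLpNorm_mul_rpow_measure_univ (μ := μ) (f := u) (p := ENNReal.ofReal s)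
      (q := (n * P : ℝ≥0)) (by
        rw [ENNReal.ofReal_le_iff_le_toReal ENNReal.coe_ne_top]; simpa using hsn) hum
    simpa [μ, c₂, hs0.le] using this
  have hgrad : eLpNorm (∇ u) 2 μ = eLpNorm (fderiv ℝ u) 2 μ :=
    eLpNorm_congr_enorm_ae (.of_forall fun x => enorm_gradient u x)
  calc ‖∫ x in Ω, g x * u x‖ₑ
      ≤ ∫⁻ x, ‖g x‖ₑ * ‖u x‖ₑ ∂μ := by
        refine (enorm_integral_le_lintegral_enorm _).trans (le_of_eq ?_)
        simp only [enorm_mul]; rfl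
    _ ≤ eLpNorm g r μ * eLpNorm u (ENNReal.ofReal s) μ := by
        refine (ENNReal.lintegral_mul_le_Lp_mul_Lq μ hrs hg.aestronglyMeasurable.enorm
          hum.enorm).trans (le_of_eq ?_)
        rw [eLpNorm_eq_lintegral_rpow_enorm_toReal (p := (r : ℝ≥0∞))
            (by exact_mod_cast (show (r : ℝ) ≠ 0 by positivity)) ENNReal.coe_ne_top,
          eLpNorm_eq_lintegral_rpow_enorm_toReal (by simpa using hs0) ENNReal.ofReal_ne_top]
        simp [hs0.le]
    _ ≤ (eLpNorm g p μ * c₁) * (C * eLpNorm (∇ u) 2 μ * c₂) := by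
        rw [hgrad]
        gcongr
        exact hus.trans (by gcongr; exact hC K u hu h0)
    _ = _ := by ring

/-! ### The Dirichlet form and the residual -/

namespace SemilinearFEM

variable {N : ℕ} {Ω : Set (Space N)} {T : Geometry.SimplicialComplex ℝ (Space N)}
  {d : Space N → ℝ → ℝ} {f : Space N → ℝ}

theorem exists_forall_abs_le_of_mem_feSpace (hb : Bornology.IsBounded Ω) {v : Space N → ℝ}
    (hv : v ∈ feSpace Ω T) : ∃ M, ∀ x, |v x| ≤ M := by
  have hsub : tsupport v ⊆ closure Ω :=
    closure_mono fun x hx => by by_contra h; exact hx (hv.2.1 x h)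
  exact hv.1.bounded_above_of_compact_support
    (hb.isCompact_closure.of_isClosed_subset isClosed_closure hsub)

theorem memLp_of_mem_feSpace (hb : Bornology.IsBounded Ω) {v : Space N → ℝ}
    (hv : v ∈ feSpace Ω T) : MemLp v ∞ (volume.restrict Ω) := by
  obtain ⟨M, hM⟩ := exists_forall_abs_le_of_mem_feSpace hb hv
  exact memLp_top_of_bound hv.1.aestronglyMeasurable M (.of_forall hM)

theorem memLp_gradient (hT : IsMesh Ω T) (hΩ : IsOpen Ω) {v : Space N → ℝ}
    (hv : v ∈ feSpace Ω T) : MemLp (∇ v) ∞ (volume.restrict Ω) := by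
  obtain ⟨L, hL⟩ := hT.exists_lipschitzWith hΩ hv
  exact memLp_top_of_bound (measurable_gradient v).aestronglyMeasurable L
    (.of_forall hL.norm_gradient_le)

theorem isFiniteMeasure_restrict (hb : Bornology.IsBounded Ω) :
    IsFiniteMeasure (volume.restrict Ω) :=
  ⟨by simpa using hb.measure_lt_top⟩

theorem integrableOn_inner_gradient (hT : IsMesh Ω T) (hΩ : IsOpen Ω) (hb : Bornology.IsBounded Ω)
    {v w : Space N → ℝ} (hv : v ∈ feSpace Ω T) (hw : w ∈ feSpace Ω T) :
    IntegrableOn (fun x => inner ℝ (∇ v x) (∇ w x)) Ω := by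
  have := isFiniteMeasure_restrict hb
  obtain ⟨L, hL⟩ := hT.exists_lipschitzWith hΩ hv
  obtain ⟨L', hL'⟩ := hT.exists_lipschitzWith hΩ hw
  refine Integrable.of_bound ((measurable_gradient v).inner
    (measurable_gradient w)).aestronglyMeasurable (L * L') (.of_forall fun x => ?_)
  exact (norm_inner_le_norm _ _).trans (mul_le_mul (hL.norm_gradient_le x) (hL'.norm_gradient_le x)
    (norm_nonneg _) L.coe_nonneg)

theorem integrableOn_mul (hb : Bornology.IsBounded Ω) {g : Space N → ℝ}
    (hg : Integrable g (volume.restrict Ω)) {v : Space N → ℝ} (hv : v ∈ feSpace Ω T) :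
    IntegrableOn (fun x => g x * v x) Ω := by
  obtain ⟨M, hM⟩ := exists_forall_abs_le_of_mem_feSpace hb hv
  exact hg.mul_bdd hv.1.aestronglyMeasurable (.of_forall hM)

theorem NonlinearityAssumption.integrable_comp (hd : NonlinearityAssumption Ω d)
    (hb : Bornology.IsBounded Ω) {v : Space N → ℝ} (hv : v ∈ feSpace Ω T) :
    Integrable (fun x => d x (v x)) (volume.restrict Ω) := by
  have := isFiniteMeasure_restrict hb
  obtain ⟨M, hM⟩ := exists_forall_abs_le_of_mem_feSpace hb hv
  obtain ⟨C, hC⟩ := hd.exists_forall_abs_le M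
  refine Integrable.of_bound (hd.aestronglyMeasurable_comp hv.1.measurable) C ?_
  filter_upwards [hC] with x hx using hx _ (hM x)

/-- The Dirichlet inner product on the finite element space, given that it is definite. -/
@[reducible]
noncomputable def dirichletCore (hT : IsMesh Ω T) (hΩ : IsOpen Ω) (hb : Bornology.IsBounded Ω)
    (hdef : ∀ v ∈ feSpace Ω T, ∫ x in Ω, inner ℝ (∇ v x) (∇ v x) = 0 → v = 0) :
    InnerProductSpace.Core ℝ (feSpace Ω T) where
  inner u v := ∫ x in Ω, inner ℝ (∇ (u : Space N → ℝ) x) (∇ (v : Space N → ℝ) x)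
  conj_inner_symm u v := by
    rw [conj_trivial]
    exact integral_congr_ae (.of_forall fun x => real_inner_comm _ _)
  re_inner_nonneg u := integral_nonneg fun x => real_inner_self_nonneg
  add_left u v w := by
    rw [← integral_add (integrableOn_inner_gradient hT hΩ hb u.2 w.2)
      (integrableOn_inner_gradient hT hΩ hb v.2 w.2)]
    obtain ⟨L, hL⟩ := hT.exists_lipschitzWith hΩ u.2
    obtain ⟨L', hL'⟩ := hT.exists_lipschitzWith hΩ v.2
    -- Gradients add only where both functions are differentiable, which is almost everywhere by
    -- Rademacher.
    refine integral_congr_ae (ae_restrict_of_ae ?_)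
    filter_upwards [hL.ae_differentiableAt, hL'.ae_differentiableAt] with x hu hv
    rw [Submodule.coe_add, gradient_add_apply hu hv, inner_add_left]
  smul_left u v a := by
    rw [← integral_const_mul]
    obtain ⟨L, hL⟩ := hT.exists_lipschitzWith hΩ u.2
    refine integral_congr_ae (ae_restrict_of_ae ?_)
    filter_upwards [hL.ae_differentiableAt] with x hu
    rw [Submodule.coe_smul, gradient_const_smul_apply hu, inner_smul_left]
  definite u hu := Subtype.ext (hdef u u.2 hu)

/-- The residual of the discrete problem as a functional on the finite element space. -/
noncomputable def residual (hT : IsMesh Ω T) (hΩ : IsOpen Ω) (hb : Bornology.IsBounded Ω)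
    (hdef : ∀ v ∈ feSpace Ω T, ∫ x in Ω, inner ℝ (∇ v x) (∇ v x) = 0 → v = 0)
    (hd : NonlinearityAssumption Ω d) (hf : Integrable f (volume.restrict Ω))
    (u : feSpace Ω T) : feSpace Ω T →ₗ[ℝ] ℝ where
  -- The test function stands first because `add_left` and `smul_left` give linearity there.
  toFun φ := (dirichletCore hT hΩ hb hdef).inner φ u + (∫ x in Ω, d x (u.1 x) * φ.1 x) -
    ∫ x in Ω, f x * φ.1 x
  map_add' φ ψ := by
    have h1 : ∀ g : Space N → ℝ, Integrable g (volume.restrict Ω) →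
        ∫ x in Ω, g x * (φ + ψ).1 x = (∫ x in Ω, g x * φ.1 x) + ∫ x in Ω, g x * ψ.1 x := by
      intro g hg
      rw [← integral_add (integrableOn_mul hb hg φ.2) (integrableOn_mul hb hg ψ.2)]
      exact integral_congr_ae (.of_forall fun x => mul_add _ _ _)
    rw [(dirichletCore hT hΩ hb hdef).add_left, h1 _ (hd.integrable_comp hb u.2), h1 _ hf]
    ring
  map_smul' a φ := by
    have h1 : ∀ g : Space N → ℝ, ∫ x in Ω, g x * (a • φ).1 x = a * ∫ x in Ω, g x * φ.1 x := by
      intro g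
      rw [← integral_const_mul]
      exact integral_congr_ae (.of_forall fun x => mul_left_comm _ _ _)
    rw [(dirichletCore hT hΩ hb hdef).smul_left, h1, h1, RingHom.id_apply, smul_eq_mul]
    simp only [conj_trivial]
    ring

end SemilinearFEM

/-! ### Monotonicity, continuity along rays and well-posedness -/

namespace SemilinearFEM

open Filter Topology

variable {N : ℕ} {Ω : Set (Space N)} {T : Geometry.SimplicialComplex ℝ (Space N)}
  {d : Space N → ℝ → ℝ} {f : Space N → ℝ}

section Residual

variable (hT : IsMesh Ω T) (hΩ : IsOpen Ω) (hb : Bornology.IsBounded Ω)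
  (hdef : ∀ v ∈ feSpace Ω T, ∫ x in Ω, inner ℝ (∇ v x) (∇ v x) = 0 → v = 0)
  (hd : NonlinearityAssumption Ω d) (hf : Integrable f (volume.restrict Ω))

theorem residual_apply (u φ : feSpace Ω T) :
    residual hT hΩ hb hdef hd hf u φ = (∫ x in Ω, inner ℝ (∇ u.1 x) (∇ φ.1 x)) +
      (∫ x in Ω, d x (u.1 x) * φ.1 x) - ∫ x in Ω, f x * φ.1 x := by
  simp only [real_inner_comm (∇ φ.1 _)]
  rfl

theorem isDiscreteSolution_iff_residual_eq_zero (u : feSpace Ω T) :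
    IsDiscreteSolution Ω T d f u ↔ residual hT hΩ hb hdef hd hf u = 0 := by
  constructor
  · rintro ⟨-, h⟩
    ext φ
    rw [residual_apply, h φ φ.2, sub_self, LinearMap.zero_apply]
  · refine fun h => ⟨u.2, fun φ hφ => ?_⟩
    have := LinearMap.congr_fun h ⟨φ, hφ⟩
    rw [residual_apply, LinearMap.zero_apply] at this
    exact sub_eq_zero.1 this

/-- The residual is strongly monotone. -/
theorem inner_le_residual_sub (v w : feSpace Ω T) :
    (dirichletCore hT hΩ hb hdef).inner (v - w) (v - w) ≤
      (residual hT hΩ hb hdef hd hf v - residual hT hΩ hb hdef hd hf w) (v - w) := by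
  set core := dirichletCore hT hΩ hb hdef
  have h1 : core.inner (v - w) v = core.inner (v - w) (v - w) + core.inner (v - w) w := by
    have hsymm : ∀ a b, core.inner a b = core.inner b a := fun a b => by
      simpa using core.conj_inner_symm a b |>.symm
    rw [hsymm (v - w) v, hsymm (v - w) w, ← core.add_left, sub_add_cancel]
  have h2 : (∫ x in Ω, d x (w.1 x) * (v - w).1 x) ≤ ∫ x in Ω, d x (v.1 x) * (v - w).1 x := by
    refine integral_mono_ae (integrableOn_mul hb (hd.integrable_comp hb w.2) (v - w).2)
      (integrableOn_mul hb (hd.integrable_comp hb v.2) (v - w).2) ?_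
    filter_upwards [hd.monotone] with x hx
    have hvw : (v - w).1 x = v.1 x - w.1 x := rfl
    rw [hvw]
    rcases le_total (v.1 x) (w.1 x) with h | h
    · exact mul_le_mul_of_nonpos_right (hx h) (sub_nonpos.2 h)
    · exact mul_le_mul_of_nonneg_right (hx h) (sub_nonneg.2 h)
  change _ ≤ (core.inner (v - w) v + (∫ x in Ω, d x (v.1 x) * (v - w).1 x) -
    ∫ x in Ω, f x * (v - w).1 x) - (core.inner (v - w) w +
      (∫ x in Ω, d x (w.1 x) * (v - w).1 x) - ∫ x in Ω, f x * (v - w).1 x)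
  linarith

/-- The Dirichlet part is affine in `t`. The nonlinear part converges by dominated convergence,
since for `0 < t ≤ 1` the arguments of `d x` stay in one bounded interval. -/
theorem tendsto_residual (u w : feSpace Ω T) :
    Tendsto (fun t : ℝ => residual hT hΩ hb hdef hd hf (u + t • w) w) (𝓝[>] 0)
      (𝓝 (residual hT hΩ hb hdef hd hf u w)) := by
  set core := dirichletCore hT hΩ hb hdef
  have h1 : Tendsto (fun t : ℝ => core.inner w (u + t • w)) (𝓝[>] 0) (𝓝 (core.inner w u)) := by
    have hsymm : ∀ a b, core.inner a b = core.inner b a := fun a b => by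
      simpa using core.conj_inner_symm a b |>.symm
    have : ∀ t : ℝ, core.inner w (u + t • w) = core.inner u w + t * core.inner w w := fun t => by
      rw [hsymm, core.add_left, core.smul_left, conj_trivial]
    simp only [this, hsymm w u]
    have hc : Continuous fun t : ℝ => core.inner u w + t * core.inner w w := by fun_prop
    simpa using (hc.tendsto 0).mono_left nhdsWithin_le_nhds
  refine (h1.add ?_).sub_const _
  have := isFiniteMeasure_restrict hb
  obtain ⟨M, hM⟩ := exists_forall_abs_le_of_mem_feSpace hb u.2
  obtain ⟨M', hM'⟩ := exists_forall_abs_le_of_mem_feSpace hb w.2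
  obtain ⟨C, hC⟩ := hd.exists_forall_abs_le (M + M')
  refine tendsto_integral_filter_of_dominated_convergence (fun _ => C * M')
    (.of_forall fun t => (integrableOn_mul hb (hd.integrable_comp hb (u + t • w).2)
      w.2).aestronglyMeasurable) ?_ (integrable_const _) ?_
  · filter_upwards [Ioc_mem_nhdsGT one_pos] with t ht
    filter_upwards [hC] with x hx
    have hle : |(u + t • w).1 x| ≤ M + M' := by
      change |u.1 x + t * w.1 x| ≤ _
      refine (abs_add_le _ _).trans (add_le_add (hM x) ?_)
      rw [abs_mul, abs_of_pos ht.1]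
      exact (mul_le_of_le_one_left (abs_nonneg _) ht.2).trans (hM' x)
    rw [norm_mul]
    exact mul_le_mul (hx _ hle) (hM' x) (norm_nonneg _) ((abs_nonneg _).trans (hx _ hle))
  · filter_upwards [hd.ae_continuous] with x hx
    have hc : Continuous fun t : ℝ => d x (u.1 x + t * w.1 x) * w.1 x := by fun_prop
    have := (hc.tendsto 0).mono_left (nhdsWithin_le_nhds (s := Set.Ioi 0))
    simpa using this

/-- Testing the residual of `u` with `u` itself. -/
theorem inner_add_le_residual_self (u : feSpace Ω T) :
    (dirichletCore hT hΩ hb hdef).inner u u + (∫ x in Ω, d x 0 * u.1 x) - ∫ x in Ω, f x * u.1 x ≤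
      residual hT hΩ hb hdef hd hf u u := by
  -- Comparison with `0` leaves only `d x 0` of the nonlinearity, whatever its growth.
  have h := inner_le_residual_sub hT hΩ hb hdef hd hf u 0
  rw [sub_zero, LinearMap.sub_apply] at h
  have h0 : residual hT hΩ hb hdef hd hf 0 u =
      (∫ x in Ω, d x 0 * u.1 x) - ∫ x in Ω, f x * u.1 x := by
    have hz : (dirichletCore hT hΩ hb hdef).inner u 0 = 0 := by
      have := (dirichletCore hT hΩ hb hdef).conj_inner_symm u 0
      have h' := (dirichletCore hT hΩ hb hdef).smul_left 0 u 0
      rw [zero_smul, map_zero, zero_mul] at h'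
      rw [← this, h', map_zero]
    change (dirichletCore hT hΩ hb hdef).inner u 0 + _ - _ = _
    rw [hz, zero_add]
    rfl
  linarith

end Residual

/-- Well-posedness of the discrete problem and the energy estimate, given a bound for the
right-hand side and for `d(·, 0)` in the dual of the finite element space. -/
theorem existsUnique_isDiscreteSolution (hT : IsMesh Ω T) (hΩ : IsOpen Ω)
    (hb : Bornology.IsBounded Ω)
    (hdef : ∀ v ∈ feSpace Ω T, ∫ x in Ω, inner ℝ (∇ v x) (∇ v x) = 0 → v = 0)
    (hd : NonlinearityAssumption Ω d) (hf : Integrable f (volume.restrict Ω)) {A : ℝ} (hA : 0 ≤ A)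
    (hbound : ∀ v ∈ feSpace Ω T, (∫ x in Ω, f x * v x) - (∫ x in Ω, d x 0 * v x) ≤
      A * √(∫ x in Ω, inner ℝ (∇ v x) (∇ v x))) :
    (∃! u, IsDiscreteSolution Ω T d f u) ∧
      ∀ u, IsDiscreteSolution Ω T d f u → √(∫ x in Ω, inner ℝ (∇ u x) (∇ u x)) ≤ A := by
  have := hT.finiteDimensional_feSpace
  set core := dirichletCore hT hΩ hb hdef
  set G := residual hT hΩ hb hdef hd hf
  have hnn : ∀ v, 0 ≤ core.inner v v := fun v => core.re_inner_nonneg v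
  have hself : ∀ v : feSpace Ω T, √(core.inner v v) ^ 2 - A * √(core.inner v v) ≤ G v v := by
    intro v
    have h1 := inner_add_le_residual_self hT hΩ hb hdef hd hf v
    have h2 : _ ≤ A * √(core.inner v v) := hbound v v.2
    rw [Real.sq_sqrt (hnn v)]
    linarith
  constructor
  -- On the sphere of radius `R = A + 1`, `hself` gives `G v v ≥ R ^ 2 - A * R = R > 0`, also when
  -- `A = 0`.
  · obtain ⟨u, hu⟩ := core.exists_eq_zero_of_monotone (G := G)
      (fun v w => (hnn _).trans (inner_le_residual_sub hT hΩ hb hdef hd hf v w))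
      (tendsto_residual hT hΩ hb hdef hd hf) (R := A + 1) (by linarith) (fun v hv => by
        have := hself v
        rw [hv] at this
        nlinarith)
    refine ⟨u, (isDiscreteSolution_iff_residual_eq_zero hT hΩ hb hdef hd hf u).2 hu, fun w hw => ?_⟩
    have hw' := (isDiscreteSolution_iff_residual_eq_zero hT hΩ hb hdef hd hf ⟨w, hw.1⟩).1 hw
    have h := inner_le_residual_sub hT hΩ hb hdef hd hf ⟨w, hw.1⟩ u
    rw [hw', show residual hT hΩ hb hdef hd hf u = 0 from hu, sub_zero, LinearMap.zero_apply] at h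
    have h0 := core.definite _ (le_antisymm h (hnn _))
    exact congrArg Subtype.val (sub_eq_zero.1 h0)
  · intro u hu
    have hu' := (isDiscreteSolution_iff_residual_eq_zero hT hΩ hb hdef hd hf ⟨u, hu.1⟩).1 hu
    have h := hself ⟨u, hu.1⟩
    rw [show G ⟨u, hu.1⟩ = 0 from hu', LinearMap.zero_apply] at h
    change √(core.inner ⟨u, hu.1⟩ ⟨u, hu.1⟩) ≤ A
    by_contra! hlt
    nlinarith [Real.sqrt_nonneg (core.inner ⟨u, hu.1⟩ ⟨u, hu.1⟩)]

theorem eLpNorm_gradient_eq (hT : IsMesh Ω T) (hΩ : IsOpen Ω) (hb : Bornology.IsBounded Ω)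
    {v : Space N → ℝ} (hv : v ∈ feSpace Ω T) :
    eLpNorm (∇ v) 2 (volume.restrict Ω) =
      ENNReal.ofReal √(∫ x in Ω, inner ℝ (∇ v x) (∇ v x)) := by
  have := isFiniteMeasure_restrict hb
  rw [((memLp_gradient hT hΩ hv).mono_exponent le_top).eLpNorm_eq_integral_rpow_norm (by simp)
    (by simp), Real.sqrt_eq_rpow]
  simp

end SemilinearFEM

/-! ### The main theorem -/

open SemilinearFEM
theorem mainTheorem9 (N : ℕ) (hN : N = 2 ∨ N = 3) (Ω : Set (Space N))
    (hΩ : IsConvexPolyhedralDomain Ω) (p : ℝ≥0∞) (hp : (N : ℝ≥0∞) / 2 < p)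
    (𝓣 : Set (Geometry.SimplicialComplex ℝ (Space N))) (hmesh : ∀ T ∈ 𝓣, IsMesh Ω T)
    (hshape : IsShapeRegular 𝓣) (hquasi : IsQuasiUniform 𝓣) :
    ∃ c : ℝ≥0, ∀ T ∈ 𝓣, ∀ f : Space N → ℝ, MemLp f p (volume.restrict Ω) →
      ∀ d : Space N → ℝ → ℝ, NonlinearityAssumption Ω d →
        -- all integrals in the discrete problem exist
        (∀ v ∈ feSpace Ω T, ∀ φ ∈ feSpace Ω T,
          IntegrableOn (fun x => inner ℝ (∇ v x) (∇ φ x)) Ω ∧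
          IntegrableOn (fun x => d x (v x) * φ x) Ω ∧
          IntegrableOn (fun x => f x * φ x) Ω) ∧
        (∃! u : Space N → ℝ, IsDiscreteSolution Ω T d f u) ∧
        ∀ u : Space N → ℝ, IsDiscreteSolution Ω T d f u →
          eLpNorm (∇ u) 2 (volume.restrict Ω) ≤
            c * (eLpNorm f p (volume.restrict Ω) +
              eLpNorm (fun x => d x 0) ∞ (volume.restrict Ω)) := by
  have hb : Bornology.IsBounded Ω := by
    obtain ⟨S, hS⟩ := hΩ.polytope
    exact (isBounded_convexHull.2 S.finite_toSet.isBounded).subset (hS ▸ subset_closure)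
  have := isFiniteMeasure_restrict hb
  have hp1 : 1 ≤ p := by
    refine le_trans ?_ hp.le
    rw [ENNReal.le_div_iff_mul_le (by simp) (by simp), one_mul]
    rcases hN with rfl | rfl <;> norm_num
  obtain ⟨C₁, hC₁⟩ := LipschitzWith.exists_enorm_integral_mul_le hN hb hΩ.isOpen.measurableSet hp
  obtain ⟨C₂, hC₂⟩ := LipschitzWith.exists_enorm_integral_mul_le hN hb hΩ.isOpen.measurableSet
    (p := ∞) (ENNReal.div_lt_top (by simp) (by simp))
  -- Both constants are fixed before the mesh, `f` and `d` are introduced.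
  refine ⟨max C₁ C₂, fun T hT𝓣 f hf d hd => ?_⟩
  have hT := hmesh T hT𝓣
  have hfi : Integrable f (volume.restrict Ω) := hf.integrable hp1
  refine ⟨fun v hv φ hφ => ⟨integrableOn_inner_gradient hT hΩ.isOpen hb hv hφ,
    integrableOn_mul hb (hd.integrable_comp hb hv) hφ, integrableOn_mul hb hfi hφ⟩, ?_⟩
  have hbd : ∀ v ∈ feSpace Ω T, ∀ (q : ℝ≥0∞) (C : ℝ≥0) (g : Space N → ℝ),
      MemLp g q (volume.restrict Ω) →
      ‖∫ x in Ω, g x * v x‖ₑ ≤ C * eLpNorm g q (volume.restrict Ω) *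
        eLpNorm (∇ v) 2 (volume.restrict Ω) →
      |∫ x in Ω, g x * v x| ≤ C * (eLpNorm g q (volume.restrict Ω)).toReal *
        √(∫ x in Ω, inner ℝ (∇ v x) (∇ v x)) := by
    intro v hv q C g hg h
    rw [eLpNorm_gradient_eq hT hΩ.isOpen hb hv] at h
    have hg' := hg.eLpNorm_ne_top
    have := ENNReal.toReal_mono (by finiteness) h
    simpa [Real.sqrt_nonneg] using this
  have hdef : ∀ v ∈ feSpace Ω T, ∫ x in Ω, inner ℝ (∇ v x) (∇ v x) = 0 → v = 0 := by
    intro v hv h0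
    obtain ⟨L, hL⟩ := hT.exists_lipschitzWith hΩ.isOpen hv
    have hvm := memLp_of_mem_feSpace hb hv
    -- The choice `g = v` makes this a Poincaré-type bound: zero Dirichlet energy forces
    -- $\int_\Omega v^2=0$.
    have h := hbd v hv ∞ C₂ v hvm (hC₂ L v hL hv.2.1 v hvm)
    rw [h0, Real.sqrt_zero, mul_zero, abs_nonpos_iff,
      integral_eq_zero_iff_of_nonneg (fun x => mul_self_nonneg _)
        (integrableOn_mul hb (hvm.integrable le_top) hv)] at h
    have hae : v =ᵐ[volume.restrict Ω] 0 := by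
      filter_upwards [h] with x hx using mul_self_eq_zero.1 hx
    have hon := Measure.eqOn_open_of_ae_eq hae hΩ.isOpen hv.1.continuousOn continuousOn_const
    ext x
    by_cases hx : x ∈ Ω
    · exact hon hx
    · exact hv.2.1 x hx
  set F := (eLpNorm f p (volume.restrict Ω)).toReal
  set D := (eLpNorm (fun x => d x 0) ∞ (volume.restrict Ω)).toReal
  have hF : 0 ≤ F := ENNReal.toReal_nonneg
  have hD : 0 ≤ D := ENNReal.toReal_nonneg
  obtain ⟨hex, hest⟩ := existsUnique_isDiscreteSolution hT hΩ.isOpen hb hdef hd hfi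
    (A := (max C₁ C₂ : ℝ≥0) * (F + D)) (by positivity) (by
      intro v hv
      obtain ⟨L, hL⟩ := hT.exists_lipschitzWith hΩ.isOpen hv
      have h1 := hbd v hv p C₁ f hf (hC₁ L v hL hv.2.1 f hf)
      have h2 := hbd v hv ∞ C₂ _ (hd.memLp_top 0) (hC₂ L v hL hv.2.1 _ (hd.memLp_top 0))
      set E := √(∫ x in Ω, inner ℝ (∇ v x) (∇ v x))
      have h3 : C₁ * F * E ≤ (max C₁ C₂ : ℝ≥0) * F * E := by gcongr; exact le_max_left _ _
      have h4 : C₂ * D * E ≤ (max C₁ C₂ : ℝ≥0) * D * E := by gcongr; exact le_max_right _ _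
      have h5 := le_abs_self (∫ x in Ω, f x * v x)
      have h6 := neg_abs_le (∫ x in Ω, d x 0 * v x)
      linarith)
  refine ⟨hex, fun u hu => ?_⟩
  rw [eLpNorm_gradient_eq hT hΩ.isOpen hb hu.1]
  refine (ENNReal.ofReal_le_ofReal (hest u hu)).trans (le_of_eq ?_)
  rw [ENNReal.ofReal_mul NNReal.zero_le_coe, ENNReal.ofReal_add hF hD, ENNReal.ofReal_coe_nnreal,
    ENNReal.ofReal_toReal hf.eLpNorm_ne_top, ENNReal.ofReal_toReal (hd.memLp_top 0).eLpNorm_ne_top]
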